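/- Let $D\ge 0$, let $\Theta=\prod_{i=1}^D\Theta_i\subset\mathbb R^D$ with each $\Theta_i\subset\mathbb R$ finite and non-empty, let $U\in C^2(\mathbb R^D)$ have an $L$-Lipschitz gradient, and let $a\in\arg\min_{\theta\in\Theta}\|\nabla U(\theta)\|$. Let $\alpha,\alpha_a,\eta>0$ and $s,t\in\mathbb R$. Write $$\nabla_\theta U_\eta(\theta,\theta_a)=\nabla U(\theta)-\tfrac1\eta(\theta-\theta_a),\qquad \nabla_{\theta_a}U_\eta(\theta,\theta_a)=\tfrac1\eta(\theta-\theta_a).$$ Consider the Markov chain on $\Theta\times\mathbb R^D$ with transition kernel $P$ which from $(\theta,\theta_a)$ draws, independently, the coordinates $\theta'_i\in\Theta_i$ with probabilities proportional to $\exp\{-\frac1{2\alpha}(\theta_i'-\theta_i-s\,\nabla_\theta U_\eta(\theta,\theta_a)_i)^2\}$, and $\theta_a'\sim N(\theta_a+t\,\nabla_{\theta_a}U_\eta(\theta,\theta_a),\ \alpha_a I)$. The algorithm EDULA (entropic discrete unadjusted Langevin algorithm) is the case $s=\alpha/2$, $t=\alpha_a/2$. (The auxiliary variable $\theta_a$ is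 not restricted to a compact set.) Put $V(\theta,\theta_a)=\|\theta_a\|^2$, $S=\sup_{\theta\in\Theta}\|\theta\|$, $$\lambda=2\Big(1-\frac t\eta\Big)^2,\qquad b=\alpha_aD+2\frac{t^2}{\eta^2}S^2,\qquad M(x)=2+\frac b{1-\lambda}+V(x),$$ and assume $\lambda<1$. For $\ell>0$ let $C_\ell=\{x\in\Theta\times\mathbb R^D: V(x)\le\ell\}$, let $\mu$ be the product of the counting measure on $\Theta$ and Lebesgue measure on $\mathbb R^D$, and put $\varepsilon_\ell=\bar\eta_\ell\,\mu(C_\ell)$ with $$\bar\eta_\ell=\frac{1}{(2\pi\alpha_a)^{D/2}}\,e^{-2\ell/\alpha_a}\cdot\frac1{|\Theta|}\exp\Big\{-\frac1{2\alpha}\Big[(1+|s|L)\operatorname{diam}(\Theta)+|s|\,\|\nabla U(a)\|+\frac{|s|}{\eta}\big(S+\sqrt\ell\big)\Big]^2\Big\}.$$ For $0<r<1$ let $$\rho_{\ell,r}=\max\left\{(1-\varepsilon_\ell)^r,\ \left(\frac{1+2b+\lambda+\lambda\ell}{1+\ell}\right)^{1-r}(1+2b+2\lambda\ell)^r\right\}.$$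 Then there is a probability measure $\pi_\gamma$ on $\Theta\times\mathbb R^D$, invariant for $P$, such that for all $\ell>0$, all $r\in(0,1)$, all $x\in\Theta\times\mathbb R^D$ and all integers $k\ge0$, $$\|P^k(x,\cdot)-\pi_\gamma\|_{TV}\le M(x)\,\rho_{\ell,r}^{\,k},\qquad \|\mu_1-\mu_2\|_{TV}=\sup_{A}|\mu_1(A)-\mu_2(A)|.$$ Moreover, whenever $(1-\lambda)\ell>2b+\lambda$ one has $\varepsilon_\ell>0$, and $\rho_{\ell,r}<1$ for all sufficiently small $r>0$; in particular the chain is geometrically ergodic. (Where $\rho_{\ell,r}\ge1$ the bound is trivial, since $M\ge2$.) -/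

import Mathlib

open MeasureTheory ProbabilityTheory Filter Topology
open scoped NNReal ENNReal

namespace EDULA

noncomputable section

/-- The Euclidean space `ℝ^D`. -/
abbrev E (D : ℕ) : Type := EuclideanSpace ℝ (Fin D)

/-- The factorized discrete domain `Θ = ∏ i, Θ i ⊆ ℝ^D`, each `Θ i` a finite set of reals. -/
def Dom {D : ℕ} (Θ : Fin D → Finset ℝ) : Set (E D) := {θ | ∀ i, θ i ∈ Θ i}

/-- The joint state space `Θ × ℝ^D` of pairs `(θ, θₐ)`. -/
abbrev State {D : ℕ} (Θ : Fin D → Finset ℝ) : Type := Dom Θ × E D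

/-- The domain is finite. -/
instance instFiniteDom {D : ℕ} (Θ : Fin D → Finset ℝ) : Finite (Dom Θ) := by
  have h : Function.Injective
      (fun (θ : Dom Θ) (i : Fin D) => (⟨(θ : E D) i, θ.2 i⟩ : (Θ i : Set ℝ))) := by
    intro x y hxy
    apply Subtype.ext
    ext i
    have := congrFun hxy i
    simpa using this
  exact Finite.of_injective _ h

/-- The reference measure: the product of the counting measure on `Θ` and Lebesgue measure. -/
def refMeasure {D : ℕ} (Θ : Fin D → Finset ℝ) : Measure (State Θ) :=
  (Measure.count : Measure (Dom Θ)).prod volume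

/-- `∇_θ U_η(θ, θₐ) = ∇U(θ) - (θ - θₐ) / η`, where `U_η(θ, θₐ) = U(θ) - ‖θ - θₐ‖² / (2η)`. -/
def gradMain {D : ℕ} (U : E D → ℝ) (η : ℝ) (θ θa : E D) : E D :=
  gradient U θ - (1 / η) • (θ - θa)

/-- `∇_{θₐ} U_η(θ, θₐ) = (θ - θₐ) / η`. -/
def gradAux {D : ℕ} (η : ℝ) (θ θa : E D) : E D := (1 / η) • (θ - θa)

/-- The categorical law on the finite set `S` with weights `exp (-(y - u - s g)² / (2α))`, `y ∈ S`:
the one-coordinate discrete Langevin proposal from `u`, with gradient coordinate `g` and gradient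
step `s`. -/
def catProb (S : Finset ℝ) (α s u g y : ℝ) : ℝ :=
  Real.exp (-(y - u - s * g) ^ 2 / (2 * α)) / ∑ z ∈ S, Real.exp (-(z - u - s * g) ^ 2 / (2 * α))

/-- For gradient step `α / 2` the one-coordinate proposal is
`Cat (Softmax (½ g (y - u) - (y - u)² / (2α)))`. -/
theorem catProb_half (S : Finset ℝ) (α u g y : ℝ) (hα : 0 < α) :
    catProb S α (α / 2) u g y =
      Real.exp (1 / 2 * g * (y - u) - (y - u) ^ 2 / (2 * α)) /
        ∑ z ∈ S, Real.exp (1 / 2 * g * (z - u) - (z - u) ^ 2 / (2 * α)) := by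
  have key : ∀ z : ℝ, Real.exp (-(z - u - α / 2 * g) ^ 2 / (2 * α)) =
      Real.exp (-(α * g ^ 2 / 8)) * Real.exp (1 / 2 * g * (z - u) - (z - u) ^ 2 / (2 * α)) := by
    intro z
    rw [← Real.exp_add]
    congr 1
    field_simp
    ring
  simp only [catProb, key]
  rw [← Finset.mul_sum, mul_div_mul_left _ _ (Real.exp_pos _).ne']

/-- The discrete proposal `q(θ' | θ, θₐ)`: independent coordinates. -/
def mainDensity {D : ℕ} (Θ : Fin D → Finset ℝ) (U : E D → ℝ) (α η s : ℝ) (θ θa θ' : E D) : ℝ :=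
  ∏ i, catProb (Θ i) α s (θ i) (gradMain U η θ θa i) (θ' i)

/-- The Lebesgue density of `θₐ' = θₐ + t ∇_{θₐ} U_η(θ, θₐ) + √αₐ ε` with `ε ∼ N(0, I)`. -/
def auxDensity {D : ℕ} (αa η t : ℝ) (θ θa θa' : E D) : ℝ :=
  (√(2 * Real.pi * αa) ^ D)⁻¹ * Real.exp (-‖θa' - θa - t • gradAux η θ θa‖ ^ 2 / (2 * αa))

/-- The joint transition density with respect to `refMeasure`, with gradient steps `s` (discrete
variable) and `t` (auxiliary variable). -/
def transDensity {D : ℕ} (Θ : Fin D → Finset ℝ) (U : E D → ℝ) (α αa η s t : ℝ)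
    (x x' : State Θ) : ℝ :=
  mainDensity Θ U α η s x.1 x.2 x'.1 * auxDensity αa η t x.1 x.2 x'.2

theorem measurable_transDensity {D : ℕ} (Θ : Fin D → Finset ℝ) (U : E D → ℝ)
    (α αa η s t : ℝ) :
    Measurable (Function.uncurry
      (fun x x' : State Θ => ENNReal.ofReal (transDensity Θ U α αa η s t x x'))) := by
  have hg : Measurable (fun θ : Dom Θ => gradient U (θ : E D)) := measurable_of_finite _
  have hg0 : Measurable (fun p : State Θ × State Θ => gradient U (p.1.1 : E D)) :=
    hg.comp (measurable_fst.comp measurable_fst)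
  have h1 : Measurable (fun p : State Θ × State Θ => (p.1.1 : E D)) :=
    measurable_subtype_coe.comp (measurable_fst.comp measurable_fst)
  have h2 : Measurable (fun p : State Θ × State Θ => (p.2.1 : E D)) :=
    measurable_subtype_coe.comp (measurable_fst.comp measurable_snd)
  have h3 : Measurable (fun p : State Θ × State Θ => p.1.2) := measurable_snd.comp measurable_fst
  have h4 : Measurable (fun p : State Θ × State Θ => p.2.2) := measurable_snd.comp measurable_snd
  have hG : Measurable (fun p : State Θ × State Θ => gradMain U η p.1.1 p.1.2) :=
    hg0.sub ((h1.sub h3).const_smul (1 / η))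
  have hA : Measurable (fun p : State Θ × State Θ => gradAux η (p.1.1 : E D) p.1.2) :=
    (h1.sub h3).const_smul (1 / η)
  have coord : ∀ {f : State Θ × State Θ → E D}, Measurable f → ∀ i, Measurable fun p => f p i :=
    fun hf i => (EuclideanSpace.proj i).continuous.measurable.comp hf
  have hmain : Measurable
      (fun p : State Θ × State Θ => mainDensity Θ U α η s p.1.1 p.1.2 p.2.1) := by
    refine Finset.measurable_prod _ fun i _ => ?_
    have a1 := coord h1 i
    have a2 := coord h2 i
    have a3 := coord hG i
    have num : ∀ {f : State Θ × State Θ → ℝ}, Measurable f → Measurable fun p =>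
        Real.exp (-(f p - (p.1.1 : E D) i - s * gradMain U η p.1.1 p.1.2 i) ^ 2 / (2 * α)) :=
      fun hf => Real.measurable_exp.comp
        (((((hf.sub a1).sub (a3.const_mul s)).pow_const 2).neg).div_const (2 * α))
    exact (num a2).div (Finset.measurable_sum _ fun z _ => num measurable_const)
  have haux : Measurable
      (fun p : State Θ × State Θ => auxDensity αa η t (p.1.1 : E D) p.1.2 p.2.2) :=
    (Real.measurable_exp.comp
      (((((h4.sub h3).sub (hA.const_smul t)).norm.pow_const 2).neg).div_const (2 * αa))).const_mul _
  exact ENNReal.measurable_ofReal.comp (hmain.mul haux)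

/-- The transition kernel of the entropic discrete unadjusted Langevin chain on `Θ × ℝ^D`,
`P(x, A) = ∫_A p(x' | x) dμ(x')`. The algorithm EDULA has gradient steps `s = α / 2` and
`t = αₐ / 2`. -/
def edulaKernel {D : ℕ} (Θ : Fin D → Finset ℝ) (U : E D → ℝ) (α αa η s t : ℝ) :
    Kernel (State Θ) (State Θ) where
  toFun x := (refMeasure Θ).withDensity
    (fun x' => ENNReal.ofReal (transDensity Θ U α αa η s t x x'))
  measurable' := by
    refine Measure.measurable_of_measurable_coe _ fun A hA => ?_
    simp only [withDensity_apply _ hA]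
    have : SFinite ((refMeasure Θ).restrict A) := by unfold refMeasure; infer_instance
    exact (measurable_transDensity Θ U α αa η s t).lintegral_prod_right

/-- Total variation distance `sup_A |μ(A) - ν(A)|` over measurable sets `A`. -/
def tvDist {X : Type*} [MeasurableSpace X] (μ ν : Measure X) : ℝ :=
  ⨆ A : {A : Set X // MeasurableSet A}, |μ.real A - ν.real A|

/-- The Lyapunov function `V(θ, θₐ) = ‖θₐ‖²`. -/
def V {D : ℕ} {Θ : Fin D → Finset ℝ} (x : State Θ) : ℝ := ‖x.2‖ ^ 2

/-- `sup_{θ ∈ Θ} ‖θ‖`. -/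
def supNorm {D : ℕ} (Θ : Fin D → Finset ℝ) : ℝ := ⨆ θ : Dom Θ, ‖(θ : E D)‖

/-- The drift factor `λ = 2 (1 - t/η)²`. -/
def driftRate (η t : ℝ) : ℝ := 2 * (1 - t / η) ^ 2

/-- The drift constant `b = αₐ D + 2 (t/η)² sup_{θ ∈ Θ} ‖θ‖²`. -/
def driftConst {D : ℕ} (Θ : Fin D → Finset ℝ) (αa η t : ℝ) : ℝ :=
  αa * D + 2 * (t / η) ^ 2 * supNorm Θ ^ 2

/-- The small set `C = {V ≤ ℓ}`. -/
def smallSet {D : ℕ} (Θ : Fin D → Finset ℝ) (ℓ : ℝ) : Set (State Θ) := {x | V x ≤ ℓ}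

/-- The density level `η̄` of the minorization on `{V ≤ ℓ}`; `L` is the Lipschitz constant of `∇U`
and `G = min_{θ ∈ Θ} ‖∇U(θ)‖`. -/
def minorLevel {D : ℕ} (Θ : Fin D → Finset ℝ) (α αa η s L G ℓ : ℝ) : ℝ :=
  (√(2 * Real.pi * αa) ^ D)⁻¹ * Real.exp (-(2 * ℓ / αa)) *
    ((Nat.card (Dom Θ) : ℝ)⁻¹ *
      Real.exp (-(1 / (2 * α)) *
        ((1 + |s| * L) * Metric.diam (Dom Θ) + |s| * G + |s| / η * (supNorm Θ + √ℓ)) ^ 2))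

/-- The minorization mass `ε = η̄ μ(C)`. -/
def minorMass {D : ℕ} (Θ : Fin D → Finset ℝ) (α αa η s L G ℓ : ℝ) : ℝ :=
  minorLevel Θ α αa η s L G ℓ * (refMeasure Θ).real (smallSet Θ ℓ)

/-- The prefactor `M(x) = 2 + b / (1 - λ) + V(x)`. -/
def prefactor {D : ℕ} (Θ : Fin D → Finset ℝ) (αa η t : ℝ) (x : State Θ) : ℝ :=
  2 + driftConst Θ αa η t / (1 - driftRate η t) + V x

/-- The rate
`ρ = max {(1 - ε)^r, ((1 + 2b + λ + λℓ) / (1 + ℓ))^(1 - r) (1 + 2b + 2λℓ)^r}`. -/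
def rate {D : ℕ} (Θ : Fin D → Finset ℝ) (α αa η s t L G ℓ r : ℝ) : ℝ :=
  max ((1 - minorMass Θ α αa η s L G ℓ) ^ r)
    (((1 + 2 * driftConst Θ αa η t + driftRate η t + driftRate η t * ℓ) / (1 + ℓ)) ^ (1 - r) *
      (1 + 2 * driftConst Θ αa η t + 2 * driftRate η t * ℓ) ^ r)

end

end EDULA

/-! The proof is an analytic form of Rosenthal's drift-and-minorization argument, with no coupling.
Fix `A` and let `u k x` be the probability of `A` after `k` steps from `x`. Its oscillation is
controlled by `p + q * (1 + W x + W y)`. If `x` or `y` lies outside the small set, one step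
multiplies `q` by `β < 1`. If both lie inside, removing a common minorizing measure multiplies `p`
by `1 - ε`, while `q` grows at most by the factor `B`. Induction on `k` gives a bound with a free
parameter `c`, which plays the role of the number of joint visits to the small set; `c = r * k`
gives the rate.

The drift bounds the mean of `W` along the chain started at a zero `x₀` of `W`, so the laws `P ^ n`
at `x₀` are uniformly Cauchy over measurable sets. Their setwise limit is the invariant law, and the
bound passes to the limit.

For the Langevin chain, the auxiliary mean is `(1 - t / η) θₐ + (t / η) θ`, which gives the drift of
`‖θₐ‖ ^ 2`. On a sublevel set of `V` both factors of the transition density are bounded below by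
explicit constants. The carriers are `abs_pow_sub_pow_le`, `exists_setwise_limit`,
`hasDrift_edulaKernel` and `exists_minorization`. -/

namespace DriftMinorization

/-! ### Oscillation bounds and comparison of integrals. -/

theorem exists_centering {X : Type*} {u w : X → ℝ} (h : ∀ x y, |u x - u y| ≤ w x + w y) :
    ∃ c, ∀ x, |u x - c| ≤ w x := by
  rcases isEmpty_or_nonempty X with hX | hX
  · exact ⟨0, fun x => hX.elim x⟩
  -- The intervals `[u x - w x, u x + w x]` meet pairwise, so all of them share a point: Helly's
  -- theorem on the line.
  obtain ⟨c, hc1, hc2⟩ := exists_between_of_forall_le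
    (s := Set.range fun x => u x - w x) (t := Set.range fun y => u y + w y)
    (Set.range_nonempty _) (Set.range_nonempty _) (by
      rintro _ ⟨x, rfl⟩ _ ⟨y, rfl⟩
      have := (abs_le.1 (h x y)).2
      simp only
      linarith)
  refine ⟨c, fun x => abs_le.2 ⟨?_, ?_⟩⟩
  · have := hc2 ⟨x, rfl⟩
    simp only at this
    linarith
  · have := hc1 ⟨x, rfl⟩
    simp only at this
    linarith

variable {X : Type*} [MeasurableSpace X]

/-- Geometric drift of the nonnegative function `W` along the kernel `P`. -/
structure HasDrift (P : Kernel X X) (W : X → ℝ) (lam b : ℝ) : Prop where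
  measurable : Measurable W
  nonneg : ∀ x, 0 ≤ W x
  lam_nonneg : 0 ≤ lam
  lam_lt_one : lam < 1
  b_nonneg : 0 ≤ b
  lintegral_le : ∀ x, ∫⁻ y, ENNReal.ofReal (W y) ∂P x ≤ ENNReal.ofReal (lam * W x + b)

theorem integrable_of_lintegral_ofReal_le {μ : Measure X} {W : X → ℝ} {c : ℝ}
    (hm : Measurable W) (h0 : ∀ x, 0 ≤ W x)
    (h : ∫⁻ y, ENNReal.ofReal (W y) ∂μ ≤ ENNReal.ofReal c) : Integrable W μ :=
  (lintegral_ofReal_ne_top_iff_integrable hm.aestronglyMeasurable (ae_of_all _ h0)).1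
    (h.trans_lt ENNReal.ofReal_lt_top).ne

theorem integral_le_of_lintegral_ofReal_le {μ : Measure X} {W : X → ℝ} {c : ℝ}
    (hm : Measurable W) (h0 : ∀ x, 0 ≤ W x) (hc : 0 ≤ c)
    (h : ∫⁻ y, ENNReal.ofReal (W y) ∂μ ≤ ENNReal.ofReal c) : ∫ y, W y ∂μ ≤ c := by
  rw [integral_eq_lintegral_of_nonneg_ae (ae_of_all _ h0) hm.aestronglyMeasurable]
  exact ENNReal.toReal_le_of_le_ofReal hc h

/-- Two finite measures of equal mass integrate `u` alike up to the integral of a bound on its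
oscillation. -/
theorem abs_integral_sub_integral_le {m₁ m₂ : Measure X} [IsFiniteMeasure m₁] [IsFiniteMeasure m₂]
    (hm : m₁.real Set.univ = m₂.real Set.univ) {u W : X → ℝ} {p q : ℝ}
    (hu₁ : Integrable u m₁) (hu₂ : Integrable u m₂)
    (hW₁ : Integrable W m₁) (hW₂ : Integrable W m₂)
    (h : ∀ x y, |u x - u y| ≤ p + q * (1 + W x + W y)) :
    |∫ x, u x ∂m₁ - ∫ x, u x ∂m₂| ≤
      m₁.real Set.univ * (p + q) + q * (∫ x, W x ∂m₁ + ∫ x, W x ∂m₂) := by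
  -- The constant `p + q` is split evenly between the two points. The centre `c` drops out in the
  -- end because the masses agree.
  obtain ⟨c, hc⟩ := exists_centering (u := u) (w := fun x => (p + q) / 2 + q * W x)
    (fun x y => (h x y).trans_eq (by ring))
  have key : ∀ (m : Measure X) [IsFiniteMeasure m], Integrable u m → Integrable W m →
      |∫ x, u x ∂m - m.real Set.univ * c| ≤
        m.real Set.univ * ((p + q) / 2) + q * ∫ x, W x ∂m := by
    intro m _ hu hW
    have e1 : ∫ x, u x ∂m - m.real Set.univ * c = ∫ x, (u x - c) ∂m := by
      rw [integral_sub hu (integrable_const c), integral_const, smul_eq_mul]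
    have e2 : m.real Set.univ * ((p + q) / 2) + q * ∫ x, W x ∂m =
        ∫ x, ((p + q) / 2 + q * W x) ∂m := by
      rw [integral_add (integrable_const _) (hW.const_mul q), integral_const, smul_eq_mul,
        integral_const_mul]
    rw [e1, e2]
    refine (abs_integral_le_integral_abs).trans ?_
    exact integral_mono (hu.sub (integrable_const c)).abs
      ((integrable_const _).add (hW.const_mul q)) hc
  have h1 := key m₁ hu₁ hW₁
  have h2 := key m₂ hu₂ hW₂
  rw [← hm] at h2
  rw [abs_le] at *
  constructor <;> linarith [h1.1, h1.2, h2.1, h2.2]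

/-! ### Contraction of oscillations along the kernel. -/

section Kernel

variable {P : Kernel X X} {W : X → ℝ} {lam b : ℝ}

theorem HasDrift.integrable (h : HasDrift P W lam b) (x : X) : Integrable W (P x) :=
  integrable_of_lintegral_ofReal_le h.measurable h.nonneg (h.lintegral_le x)

theorem HasDrift.integral_le (h : HasDrift P W lam b) (x : X) :
    ∫ y, W y ∂P x ≤ lam * W x + b :=
  integral_le_of_lintegral_ofReal_le h.measurable h.nonneg
    (add_nonneg (mul_nonneg h.lam_nonneg (h.nonneg x)) h.b_nonneg) (h.lintegral_le x)

theorem measurable_pow_real (k : ℕ) {A : Set X} (hA : MeasurableSet A) :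
    Measurable fun x => ((P ^ k) x).real A :=
  ((P ^ k).measurable_coe hA).ennreal_toReal

variable [IsMarkovKernel P]

theorem integrable_of_abs_le_one (x : X) {u : X → ℝ} (hu : Measurable u) (hu1 : ∀ x, |u x| ≤ 1) :
    Integrable u (P x) :=
  (integrable_const (1 : ℝ)).mono' hu.aestronglyMeasurable (ae_of_all _ hu1)

/-- Here `β = lam + (1 + 2 * b) / (1 + ℓ)`, so once `W x + W y` reaches `ℓ` the additive constant `1
+ 2 * b` is absorbed into a multiple of `1 + W x + W y`. -/
theorem abs_step_le_of_not_mem (hd : HasDrift P W lam b) {ℓ : ℝ} (hℓ : 0 < ℓ) {u : X → ℝ}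
    (hu : Measurable u) (hu1 : ∀ x, |u x| ≤ 1) {p q : ℝ} (hq : 0 ≤ q)
    (h : ∀ x y, |u x - u y| ≤ p + q * (1 + W x + W y)) {x y : X} (hxy : ℓ ≤ W x + W y) :
    |∫ z, u z ∂P x - ∫ z, u z ∂P y| ≤
      p + q * ((1 + 2 * b + lam + lam * ℓ) / (1 + ℓ)) * (1 + W x + W y) := by
  have h1 := abs_integral_sub_integral_le (m₁ := P x) (m₂ := P y) (by simp)
    (integrable_of_abs_le_one x hu hu1) (integrable_of_abs_le_one y hu hu1)
    (hd.integrable x) (hd.integrable y) h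
  simp only [probReal_univ, one_mul] at h1
  refine h1.trans ?_
  have h2 : 1 + 2 * b + lam * (W x + W y) ≤
      (1 + 2 * b + lam + lam * ℓ) / (1 + ℓ) * (1 + W x + W y) := by
    rw [div_mul_eq_mul_div, le_div_iff₀ (by linarith)]
    nlinarith [hd.lam_nonneg, hd.b_nonneg, mul_nonneg hd.b_nonneg (sub_nonneg.2 hxy)]
  have h3 : q * (1 + (∫ z, W z ∂P x + ∫ z, W z ∂P y)) ≤
      q * ((1 + 2 * b + lam + lam * ℓ) / (1 + ℓ) * (1 + W x + W y)) :=
    mul_le_mul_of_nonneg_left (by linarith [hd.integral_le x, hd.integral_le y]) hq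
  linarith

/-- The common part `ν` cancels in the difference. The residual measures `P x - ν` and `P y - ν`
have equal mass, which contracts `p`, and `W` integrates against them to at most `lam * ℓ + b`. -/
theorem abs_step_le_of_mem (hd : HasDrift P W lam b) {ℓ : ℝ} {ν : Measure X}
    (hν : ∀ x, W x ≤ ℓ → ν ≤ P x) {u : X → ℝ}
    (hu : Measurable u) (hu1 : ∀ x, |u x| ≤ 1) {p q : ℝ} (hq : 0 ≤ q)
    (h : ∀ x y, |u x - u y| ≤ p + q * (1 + W x + W y)) {x y : X} (hx : W x ≤ ℓ) (hy : W y ≤ ℓ) :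
    |∫ z, u z ∂P x - ∫ z, u z ∂P y| ≤
      (1 - ν.real Set.univ) * p + q * (1 + 2 * b + 2 * lam * ℓ) := by
  have hfin : IsFiniteMeasure ν := ⟨((hν x hx) Set.univ).trans_lt (measure_lt_top _ _)⟩
  have split : ∀ z, W z ≤ ℓ → ∀ f : X → ℝ, Integrable f (P z) →
      ∫ w, f w ∂P z = ∫ w, f w ∂(P z - ν) + ∫ w, f w ∂ν := by
    intro z hz f hf
    rw [← integral_add_measure (hf.mono_measure Measure.sub_le) (hf.mono_measure (hν z hz)),
      Measure.sub_add_cancel_of_le (hν z hz)]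
  have mass : ∀ z, W z ≤ ℓ → (P z - ν).real Set.univ = 1 - ν.real Set.univ := by
    intro z hz
    have := split z hz (fun _ => 1) (integrable_const 1)
    simp only [integral_const, smul_eq_mul, mul_one, probReal_univ] at this
    linarith
  have le : ∀ z, W z ≤ ℓ → ∫ w, W w ∂(P z - ν) ≤ lam * ℓ + b := by
    intro z hz
    have h1 := split z hz W (hd.integrable z)
    have h2 : 0 ≤ ∫ w, W w ∂ν := integral_nonneg hd.nonneg
    have h3 := hd.integral_le z
    have h4 := mul_le_mul_of_nonneg_left hz hd.lam_nonneg
    linarith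
  have ix := integrable_of_abs_le_one (P := P) x hu hu1
  have iy := integrable_of_abs_le_one (P := P) y hu hu1
  have h1 := abs_integral_sub_integral_le (m₁ := P x - ν) (m₂ := P y - ν)
    ((mass x hx).trans (mass y hy).symm)
    (ix.mono_measure Measure.sub_le) (iy.mono_measure Measure.sub_le)
    ((hd.integrable x).mono_measure Measure.sub_le)
    ((hd.integrable y).mono_measure Measure.sub_le) h
  rw [mass x hx] at h1
  rw [split x hx u ix, split y hy u iy, add_sub_add_right_eq_sub]
  have h3 := mul_le_mul_of_nonneg_left (add_le_add (le x hx) (le y hy)) hq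
  have h4 : 0 ≤ q * ν.real Set.univ := mul_nonneg hq measureReal_nonneg
  linarith

instance isMarkovKernel_pow (k : ℕ) : IsMarkovKernel (P ^ k) := by
  induction k with
  | zero => rw [pow_zero]; exact inferInstanceAs (IsMarkovKernel (Kernel.id))
  | succ k ih => rw [pow_succ]; exact inferInstanceAs (IsMarkovKernel (_ ∘ₖ _))

theorem comp_real_apply (κ κ' : Kernel X X) [IsMarkovKernel κ] [IsMarkovKernel κ'] (x : X)
    {A : Set X} (hA : MeasurableSet A) :
    ((κ' * κ) x).real A = ∫ y, (κ' y).real A ∂κ x := by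
  change ((κ' ∘ₖ κ) x).real A = _
  rw [measureReal_def, Kernel.comp_apply' _ _ _ hA, integral_eq_lintegral_of_nonneg_ae
    (ae_of_all _ fun _ => measureReal_nonneg)
    ((κ'.measurable_coe hA).ennreal_toReal).aestronglyMeasurable]
  simp [ofReal_measureReal]

/-- A tail bound valid for every real number `c` of visits to the small set. -/
theorem abs_pow_sub_pow_le (hd : HasDrift P W lam b) {ℓ : ℝ} (hℓ : 0 < ℓ) {ν : Measure X}
    (hν : ∀ x, W x ≤ ℓ → ν ≤ P x) (hν1 : ν.real Set.univ ≤ 1)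
    (hβ : (1 + 2 * b + lam + lam * ℓ) / (1 + ℓ) ≤ 1) {A : Set X} (hA : MeasurableSet A) (k : ℕ) :
    ∀ (c : ℝ) (x y : X), |((P ^ k) x).real A - ((P ^ k) y).real A| ≤
      (1 - ν.real Set.univ) ^ (max c 0) +
        ((1 + 2 * b + lam + lam * ℓ) / (1 + ℓ)) ^ ((k : ℝ) - c) *
          (1 + 2 * b + 2 * lam * ℓ) ^ c * (1 + W x + W y) := by
  set β := (1 + 2 * b + lam + lam * ℓ) / (1 + ℓ) with hβdef
  set B := 1 + 2 * b + 2 * lam * ℓ with hB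
  set δ := 1 - ν.real Set.univ with hδ
  have hδ0 : 0 ≤ δ := by linarith
  have hδ1 : δ ≤ 1 := by linarith [measureReal_nonneg (μ := ν) (s := Set.univ)]
  have hl := hd.lam_nonneg
  have hb := hd.b_nonneg
  have hlℓ := mul_nonneg hl hℓ.le
  have hβ0 : 0 < β := by positivity
  have hB1 : 1 ≤ B := by linarith
  have hB0 : 0 < B := by linarith
  induction k with
  | zero =>
    intro c x y
    have hh : 1 ≤ 1 + W x + W y := by linarith [hd.nonneg x, hd.nonneg y]
    have h1 : |((P ^ 0) x).real A - ((P ^ 0) y).real A| ≤ 1 := by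
      rw [abs_le]
      constructor <;> linarith [measureReal_nonneg (μ := (P ^ 0) x) (s := A),
        measureReal_nonneg (μ := (P ^ 0) y) (s := A),
        measureReal_le_one (μ := (P ^ 0) x) (s := A),
        measureReal_le_one (μ := (P ^ 0) y) (s := A)]
    refine h1.trans ?_
    -- The trivial bound 1 is met by the first term if `c ≤ 0`, and by the second if `c ≥ 0`, since
    -- `β ≤ 1` carries the exponent `-c`.
    rcases le_total c 0 with hc | hc
    · rw [max_eq_right hc, Real.rpow_zero]
      have : 0 ≤ β ^ (((0 : ℕ) : ℝ) - c) * B ^ c * (1 + W x + W y) := by positivity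
      linarith
    · have h2 : 1 ≤ β ^ (((0 : ℕ) : ℝ) - c) :=
        Real.one_le_rpow_of_pos_of_le_one_of_nonpos hβ0 hβ (by simpa using hc)
      have h3 : 1 ≤ B ^ c := Real.one_le_rpow hB1 hc
      have h4 : 0 ≤ δ ^ max c 0 := Real.rpow_nonneg hδ0 _
      have := one_le_mul_of_one_le_of_one_le (one_le_mul_of_one_le_of_one_le h2 h3) hh
      linarith
  | succ k ih =>
    intro c x y
    have hu : Measurable fun x => ((P ^ k) x).real A := measurable_pow_real k hA
    have hu1 : ∀ x, |((P ^ k) x).real A| ≤ 1 := fun x => by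
      rw [abs_of_nonneg measureReal_nonneg]
      exact measureReal_le_one
    rw [pow_succ, comp_real_apply _ _ x hA, comp_real_apply _ _ y hA]
    have hq : ∀ c : ℝ, 0 ≤ β ^ ((k : ℝ) - c) * B ^ c := fun c => by positivity
    by_cases hxy : W x ≤ ℓ ∧ W y ≤ ℓ
    -- A joint visit uses up one unit of `c`. As `c - 1` may be negative, the induction needs every
    -- real `c` and the truncation `max c 0`.
    · refine (abs_step_le_of_mem hd hν hu hu1 (hq (c - 1)) (ih (c - 1)) hxy.1 hxy.2).trans ?_
      have e1 : β ^ ((k : ℝ) - (c - 1)) * B ^ (c - 1) * B = β ^ (((k + 1 : ℕ) : ℝ) - c) * B ^ c := by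
        rw [mul_assoc, Real.rpow_sub_one hB0.ne', div_mul_cancel₀ _ hB0.ne']
        congr 2
        push_cast
        ring
      have e2 : δ * δ ^ max (c - 1) 0 ≤ δ ^ max c 0 := by
        rcases le_total c 1 with hc | hc
        · rw [max_eq_right (sub_nonpos.2 hc), Real.rpow_zero, mul_one]
          have : max c 0 ≤ 1 := max_le hc zero_le_one
          calc δ = δ ^ (1 : ℝ) := (Real.rpow_one δ).symm
            _ ≤ δ ^ max c 0 := by
              rcases hδ0.eq_or_lt with h0 | h0
              · rw [← h0, Real.zero_rpow one_ne_zero]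
                exact Real.rpow_nonneg le_rfl _
              · exact Real.rpow_le_rpow_of_exponent_ge h0 hδ1 this
        · rw [max_eq_left (sub_nonneg.2 hc), max_eq_left (zero_le_one.trans hc)]
          apply le_of_eq
          rw [← Real.rpow_one_add' hδ0 (by linarith)]
          congr 1
          ring
      have e3 : β ^ (((k + 1 : ℕ) : ℝ) - c) * B ^ c ≤
          β ^ (((k + 1 : ℕ) : ℝ) - c) * B ^ c * (1 + W x + W y) :=
        le_mul_of_one_le_right (by positivity) (by linarith [hd.nonneg x, hd.nonneg y])
      linarith
    · have hxy' : ℓ ≤ W x + W y := by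
        by_contra hlt
        exact hxy ⟨by linarith [hd.nonneg y], by linarith [hd.nonneg x]⟩
      refine (abs_step_le_of_not_mem hd hℓ hu hu1 (hq c) (ih c) hxy').trans_eq ?_
      congr 1
      have : β ^ (((k + 1 : ℕ) : ℝ) - c) = β ^ ((k : ℝ) - c) * β := by
        rw [← Real.rpow_add_one hβ0.ne']
        congr 1
        push_cast
        ring
      rw [this]
      ring

theorem abs_pow_sub_pow_le_rate (hd : HasDrift P W lam b) {ℓ : ℝ} (hℓ : 0 < ℓ) {ν : Measure X}
    (hν : ∀ x, W x ≤ ℓ → ν ≤ P x) (hν1 : ν.real Set.univ ≤ 1)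
    (hβ : (1 + 2 * b + lam + lam * ℓ) / (1 + ℓ) ≤ 1) {A : Set X} (hA : MeasurableSet A) (k : ℕ)
    {r : ℝ} (hr : 0 < r) (x y : X) :
    |((P ^ k) x).real A - ((P ^ k) y).real A| ≤
      (max ((1 - ν.real Set.univ) ^ r) (((1 + 2 * b + lam + lam * ℓ) / (1 + ℓ)) ^ (1 - r) *
        (1 + 2 * b + 2 * lam * ℓ) ^ r)) ^ k * (2 + W x + W y) := by
  -- With `c = r * k` both terms become `k`-th powers.
  have h := abs_pow_sub_pow_le hd hℓ hν hν1 hβ hA k (r * k) x y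
  have hl := hd.lam_nonneg
  have hb := hd.b_nonneg
  have hβ0 : 0 ≤ (1 + 2 * b + lam + lam * ℓ) / (1 + ℓ) := by positivity
  have hB0 : 0 ≤ 1 + 2 * b + 2 * lam * ℓ := by positivity
  set β := (1 + 2 * b + lam + lam * ℓ) / (1 + ℓ) with hβdef
  set B := 1 + 2 * b + 2 * lam * ℓ with hB
  set δ := 1 - ν.real Set.univ with hδ
  have hδ0 : 0 ≤ δ := by linarith
  rw [max_eq_left (by positivity), Real.rpow_mul_natCast hδ0,
    Real.rpow_mul_natCast hB0, show (k : ℝ) - r * k = (1 - r) * k by ring,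
    Real.rpow_mul_natCast hβ0, ← mul_pow] at h
  have h1 : (δ ^ r) ^ k ≤ (max (δ ^ r) (β ^ (1 - r) * B ^ r)) ^ k :=
    pow_le_pow_left₀ (by positivity) (le_max_left _ _) k
  have h2 : (β ^ (1 - r) * B ^ r) ^ k ≤ (max (δ ^ r) (β ^ (1 - r) * B ^ r)) ^ k :=
    pow_le_pow_left₀ (by positivity) (le_max_right _ _) k
  have h3 := mul_le_mul_of_nonneg_right h2
    (show 0 ≤ 1 + W x + W y by linarith [hd.nonneg x, hd.nonneg y])
  linarith

/-- `b / (1 - lam)` is the fixed point of `v ↦ lam * v + b`, and the iteration starts below it, at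
0. -/
theorem HasDrift.lintegral_pow_le (hd : HasDrift P W lam b) {x₀ : X} (h0 : W x₀ = 0) (n : ℕ) :
    ∫⁻ y, ENNReal.ofReal (W y) ∂(P ^ n) x₀ ≤ ENNReal.ofReal (b / (1 - lam)) := by
  have h1 : 0 < 1 - lam := by linarith [hd.lam_lt_one]
  have hm : Measurable fun y => ENNReal.ofReal (W y) := hd.measurable.ennreal_ofReal
  induction n with
  | zero =>
    rw [pow_zero]
    change ∫⁻ y, ENNReal.ofReal (W y) ∂(Kernel.id x₀) ≤ _
    rw [Kernel.id_apply, lintegral_dirac' _ hm, h0]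
    simp
  | succ n ih =>
    rw [pow_succ']
    change ∫⁻ y, ENNReal.ofReal (W y) ∂((P ∘ₖ (P ^ n)) x₀) ≤ _
    rw [Kernel.lintegral_comp _ _ _ hm]
    calc ∫⁻ y, ∫⁻ z, ENNReal.ofReal (W z) ∂P y ∂(P ^ n) x₀
        ≤ ∫⁻ y, (ENNReal.ofReal lam * ENNReal.ofReal (W y) + ENNReal.ofReal b) ∂(P ^ n) x₀ := by
          refine lintegral_mono fun y => (hd.lintegral_le y).trans_eq ?_
          rw [ENNReal.ofReal_add (mul_nonneg hd.lam_nonneg (hd.nonneg y)) hd.b_nonneg,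
            ENNReal.ofReal_mul hd.lam_nonneg]
      _ = ENNReal.ofReal lam * ∫⁻ y, ENNReal.ofReal (W y) ∂(P ^ n) x₀ + ENNReal.ofReal b := by
          rw [lintegral_add_right _ measurable_const, lintegral_const_mul _ hm]
          simp
      _ ≤ ENNReal.ofReal lam * ENNReal.ofReal (b / (1 - lam)) + ENNReal.ofReal b := by gcongr
      _ = ENNReal.ofReal (b / (1 - lam)) := by
          have hb := hd.b_nonneg
          have hl := hd.lam_nonneg
          rw [← ENNReal.ofReal_mul hl, ← ENNReal.ofReal_add (by positivity) hb]
          congr 1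
          field_simp
          ring

/-- The law at time `k + n` averages the laws `P ^ k` over starting points drawn from `P ^ n` at
`x₀`. The bound is uniform in `n`: it serves both for the Cauchy property and for the limit `n → ∞`.
-/
theorem abs_pow_sub_pow_add_le (hd : HasDrift P W lam b) {x₀ : X} (h0 : W x₀ = 0) {A : Set X}
    (hA : MeasurableSet A) (k n : ℕ) {R : ℝ} (hR : 0 ≤ R) (x : X)
    (h : ∀ y, |((P ^ k) x).real A - ((P ^ k) y).real A| ≤ R * (2 + W x + W y)) :
    |((P ^ k) x).real A - ((P ^ (k + n)) x₀).real A| ≤ R * (2 + b / (1 - lam) + W x) := by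
  have h1 : 0 < 1 - lam := by linarith [hd.lam_lt_one]
  have hb := hd.b_nonneg
  have hint := integrable_of_lintegral_ofReal_le hd.measurable hd.nonneg (hd.lintegral_pow_le h0 n)
  have hle := integral_le_of_lintegral_ofReal_le hd.measurable hd.nonneg (by positivity)
    (hd.lintegral_pow_le h0 n)
  have hu : Integrable (fun y => ((P ^ k) y).real A) ((P ^ n) x₀) :=
    integrable_of_abs_le_one (P := P ^ n) x₀ (measurable_pow_real k hA) fun y => by
      rw [abs_of_nonneg measureReal_nonneg]
      exact measureReal_le_one
  have e : ((P ^ k) x).real A - ((P ^ (k + n)) x₀).real A =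
      ∫ y, (((P ^ k) x).real A - ((P ^ k) y).real A) ∂(P ^ n) x₀ := by
    rw [pow_add, comp_real_apply _ _ x₀ hA, integral_sub (integrable_const _) hu]
    simp
  rw [e]
  calc |∫ y, (((P ^ k) x).real A - ((P ^ k) y).real A) ∂(P ^ n) x₀|
      ≤ ∫ y, |((P ^ k) x).real A - ((P ^ k) y).real A| ∂(P ^ n) x₀ :=
        abs_integral_le_integral_abs
    _ ≤ ∫ y, (R * (2 + W x) + R * W y) ∂(P ^ n) x₀ :=
        integral_mono ((integrable_const _).sub hu).abs
          ((integrable_const _).add (hint.const_mul R)) fun y => (h y).trans_eq (by ring)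
    _ = R * (2 + W x) + R * ∫ y, W y ∂(P ^ n) x₀ := by
        rw [integral_add (integrable_const _) (hint.const_mul R), integral_const_mul R W]
        simp
    _ ≤ R * (2 + W x) + R * (b / (1 - lam)) := by gcongr
    _ = R * (2 + b / (1 - lam) + W x) := by ring

end Kernel

/-! ### Setwise limits and invariance. -/

/-- A sequence of probability measures that is Cauchy in total variation converges setwise. -/
theorem exists_setwise_limit (μ : ℕ → Measure X) [∀ n, IsProbabilityMeasure (μ n)] {δ : ℕ → ℝ}
    (hδ : Tendsto δ atTop (𝓝 0))
    (h : ∀ A, MeasurableSet A → ∀ k n, |(μ k).real A - (μ (k + n)).real A| ≤ δ k) :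
    ∃ π : Measure X, IsProbabilityMeasure π ∧
      ∀ A, MeasurableSet A → Tendsto (fun n => (μ n).real A) atTop (𝓝 (π.real A)) := by
  have hlim : ∀ A, MeasurableSet A → ∃ l, Tendsto (fun n => (μ n).real A) atTop (𝓝 l) := by
    intro A hA
    refine cauchySeq_tendsto_of_complete (cauchySeq_of_le_tendsto_0' δ (fun m n hmn => ?_) hδ)
    obtain ⟨j, rfl⟩ := Nat.exists_eq_add_of_le hmn
    exact h A hA m j
  let f : Set X → ℝ := fun A => limUnder atTop (fun n => (μ n).real A)
  have hf : ∀ A, MeasurableSet A → Tendsto (fun n => (μ n).real A) atTop (𝓝 (f A)) :=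
    fun A hA => tendsto_nhds_limUnder (hlim A hA)
  have hf0 : ∀ A, MeasurableSet A → 0 ≤ f A :=
    fun A hA => ge_of_tendsto' (hf A hA) fun n => measureReal_nonneg
  have hfe : f ∅ = 0 := tendsto_nhds_unique (hf ∅ .empty) (by simp)
  have hfu : f Set.univ = 1 := tendsto_nhds_unique (hf _ .univ) (by simp)
  have hclose : ∀ A, MeasurableSet A → ∀ k, |(μ k).real A - f A| ≤ δ k := by
    intro A hA k
    have h1 : Tendsto (fun n => (μ (k + n)).real A) atTop (𝓝 (f A)) :=
      (hf A hA).comp (tendsto_add_atTop_nat k |>.congr fun n => by rw [add_comm])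
    exact le_of_tendsto' (h1.const_sub _).abs fun n => h A hA k n
  -- Countable additivity is an interchange of limits: `hclose` is uniform over sets, so one fixed
  -- `μ n` approximates `f` on all partial unions and on the full union.
  have hsum : ∀ A : ℕ → Set X, (∀ i, MeasurableSet (A i)) → Pairwise (Function.onFun Disjoint A) →
      HasSum (fun i => f (A i)) (f (⋃ i, A i)) := by
    intro A hA hd
    rw [hasSum_iff_tendsto_nat_of_nonneg fun i => hf0 _ (hA i)]
    let S : ℕ → Set X := fun N => ⋃ i ∈ Finset.range N, A i
    have hS : ∀ N, MeasurableSet (S N) := fun N => Finset.measurableSet_biUnion _ fun i _ => hA i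
    have hμS : ∀ n N, (μ n).real (S N) = ∑ i ∈ Finset.range N, (μ n).real (A i) := fun n N =>
      measureReal_biUnion_finset (μ := μ n) (fun i _ j _ hij => hd hij)
        (fun i _ => hA i) (by finiteness)
    have hfS : ∀ N, ∑ i ∈ Finset.range N, f (A i) = f (S N) := fun N =>
      tendsto_nhds_unique ((tendsto_finsetSum _ fun i _ => hf _ (hA i)).congr
        fun n => (hμS n N).symm) (hf _ (hS N))
    simp only [hfS]
    have hU : MeasurableSet (⋃ i, A i) := .iUnion hA
    have hμ : ∀ n, Tendsto (fun N => (μ n).real (S N)) atTop (𝓝 ((μ n).real (⋃ i, A i))) := by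
      intro n
      have h1 : HasSum (fun i => (μ n).real (A i)) ((μ n).real (⋃ i, A i)) := by
        have h2 := measure_iUnion (μ := μ n) (fun i j hij => hd hij) hA
        have h3 : ∑' i, μ n (A i) ≠ ∞ := h2 ▸ measure_ne_top (μ n) _
        rw [measureReal_def, h2, ENNReal.tsum_toReal_eq fun i => measure_ne_top (μ n) _]
        exact ENNReal.hasSum_toReal h3
      exact h1.tendsto_sum_nat.congr fun N => (hμS n N).symm
    rw [Metric.tendsto_atTop]
    intro ε hε
    obtain ⟨n, hn⟩ := (hδ.eventually (gt_mem_nhds (show (0 : ℝ) < ε / 3 by positivity))).exists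
    obtain ⟨N, hN⟩ := Metric.tendsto_atTop.1 (hμ n) (ε / 3) (by positivity)
    refine ⟨N, fun M hM => ?_⟩
    have h1 := hN M hM
    have h2 := hclose _ (hS M) n
    have h3 := hclose _ hU n
    rw [Real.dist_eq, abs_lt] at *
    rw [abs_le] at h2 h3
    constructor <;> linarith [h1.1, h1.2, h2.1, h2.2, h3.1, h3.2]
  let π : Measure X := Measure.ofMeasurable (fun A _ => ENNReal.ofReal (f A)) (by simp [hfe])
    (by
      intro A hA hd
      rw [← (hsum A hA hd).tsum_eq,
        ENNReal.ofReal_tsum_of_nonneg (fun i => hf0 _ (hA i)) (hsum A hA hd).summable])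
  have hπ : ∀ A, MeasurableSet A → π A = ENNReal.ofReal (f A) :=
    fun A hA => Measure.ofMeasurable_apply A hA
  refine ⟨π, ⟨by rw [hπ _ .univ, hfu, ENNReal.ofReal_one]⟩, fun A hA => ?_⟩
  rw [measureReal_def, hπ A hA, ENNReal.toReal_ofReal (hf0 A hA)]
  exact hf A hA

/-- Setwise convergence of probability measures gives convergence of integrals of bounded
functions. -/
theorem tendsto_lintegral_of_setwise {μ : ℕ → Measure X} {π : Measure X}
    [∀ n, IsProbabilityMeasure (μ n)] [IsProbabilityMeasure π]
    (h : ∀ A, MeasurableSet A → Tendsto (fun n => (μ n).real A) atTop (𝓝 (π.real A)))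
    {f : X → ℝ} (hf : Measurable f) (hf0 : ∀ x, 0 ≤ f x) (hf1 : ∀ x, f x ≤ 1) :
    Tendsto (fun n => ∫⁻ x, ENNReal.ofReal (f x) ∂μ n) atTop
      (𝓝 (∫⁻ x, ENNReal.ofReal (f x) ∂π)) := by
  have hA : ∀ t : ℝ, MeasurableSet {x | t < f x} := fun t => measurableSet_lt measurable_const hf
  -- The layer-cake formula reduces the claim to level sets; levels `t ≥ 1` contribute nothing, so
  -- the indicator of `t < 1` dominates.
  simp only [lintegral_eq_lintegral_meas_lt _ (ae_of_all _ hf0) hf.aemeasurable]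
  refine tendsto_lintegral_of_dominated_convergence (Set.indicator (Set.Iio (1 : ℝ)) 1)
    (fun n => ?_) (fun n => ae_of_all _ fun t => ?_) ?_ (ae_of_all _ fun t => ?_)
  · refine Antitone.measurable fun s t hst => measure_mono fun x hx => ?_
    exact lt_of_le_of_lt hst hx
  · by_cases ht : t < 1
    · rw [Set.indicator_of_mem (Set.mem_Iio.2 ht)]
      exact prob_le_one
    · have : {x | t < f x} = ∅ := by
        ext x
        simpa using (hf1 x).trans (not_lt.1 ht)
      simp [this]
  · rw [lintegral_indicator_one measurableSet_Iio, Measure.restrict_apply measurableSet_Iio]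
    refine ((measure_mono (t := Set.Icc (0 : ℝ) 1) ?_).trans_lt measure_Icc_lt_top).ne
    rintro t ⟨ht1, ht0⟩
    exact ⟨(Set.mem_Ioi.1 ht0).le, (Set.mem_Iio.1 ht1).le⟩
  · exact (ENNReal.tendsto_toReal_iff (fun n => measure_ne_top _ _) (measure_ne_top _ _)).1
      (h _ (hA t))

/-- The function `P · A` is bounded and measurable, so setwise convergence lets the limit pass
through one more step; no continuity of `P` is needed. -/
theorem invariant_of_setwise_limit {P : Kernel X X} [IsMarkovKernel P] {π : Measure X}
    [IsProbabilityMeasure π] {x₀ : X}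
    (h : ∀ A, MeasurableSet A → Tendsto (fun n => ((P ^ n) x₀).real A) atTop (𝓝 (π.real A))) :
    P.Invariant π := by
  refine Measure.ext fun A hA => ?_
  rw [Measure.bind_apply hA P.aemeasurable]
  have h1 := tendsto_lintegral_of_setwise h (measurable_pow_real (P := P) 1 hA)
    (fun x => measureReal_nonneg) (fun x => measureReal_le_one)
  have h3 : ∀ x, ENNReal.ofReal (((P ^ 1) x).real A) = P x A := fun x => by
    rw [pow_one, ofReal_measureReal]
  simp only [h3] at h1
  have h2 : ∀ n, ∫⁻ x, P x A ∂(P ^ n) x₀ = (P ^ (n + 1)) x₀ A := fun n => by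
    rw [pow_succ']
    exact (Kernel.comp_apply' _ _ _ hA).symm
  simp only [h2] at h1
  refine tendsto_nhds_unique h1 ?_
  exact ((ENNReal.tendsto_toReal_iff (fun n => measure_ne_top _ _) (measure_ne_top _ _)).1
    (h A hA)).comp (tendsto_add_atTop_nat 1)

theorem rate_lt_one {ε β B : ℝ} (hε0 : 0 < ε) (hε1 : ε ≤ 1) (hβ0 : 0 < β) (hβ1 : β < 1)
    (hB : 0 < B) : ∀ᶠ r in 𝓝[>] (0 : ℝ), max ((1 - ε) ^ r) (β ^ (1 - r) * B ^ r) < 1 := by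
  have h1 : Tendsto (fun r : ℝ => β ^ (1 - r) * B ^ r) (𝓝[>] 0) (𝓝 β) := by
    have h2 : Continuous fun r : ℝ => β ^ (1 - r) * B ^ r :=
      ((Real.continuous_const_rpow hβ0.ne').comp (continuous_const.sub continuous_id)).mul
        (Real.continuous_const_rpow hB.ne')
    have h3 := (h2.tendsto 0).mono_left (nhdsWithin_le_nhds (s := Set.Ioi 0))
    simpa using h3
  filter_upwards [h1.eventually (gt_mem_nhds hβ1), self_mem_nhdsWithin] with r hr hr0
  exact max_lt (Real.rpow_lt_one (by linarith) (by linarith) hr0) hr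

theorem tvDist_le {μ ν : Measure X} {c : ℝ}
    (h : ∀ A, MeasurableSet A → |μ.real A - ν.real A| ≤ c) : EDULA.tvDist μ ν ≤ c :=
  have : Nonempty {A : Set X // MeasurableSet A} := ⟨⟨∅, .empty⟩⟩
  ciSup_le fun A => h A.1 A.2

theorem tvDist_le_one (μ ν : Measure X) [IsProbabilityMeasure μ] [IsProbabilityMeasure ν] :
    EDULA.tvDist μ ν ≤ 1 :=
  tvDist_le fun A _ => by
    rw [abs_le]
    constructor <;> linarith [measureReal_nonneg (μ := μ) (s := A),
      measureReal_nonneg (μ := ν) (s := A), measureReal_le_one (μ := μ) (s := A),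
      measureReal_le_one (μ := ν) (s := A)]

/-! ### The abstract ergodicity theorem. -/

/-- Quantitative geometric ergodicity from a drift condition and minorizations on sublevel sets:
`ε ℓ` is a mass of a minorizing measure on `{W ≤ ℓ}` for every large `ℓ`. -/
theorem exists_invariant_of_drift_of_minorization {P : Kernel X X} [IsMarkovKernel P] {W : X → ℝ}
    {lam b : ℝ} (hd : HasDrift P W lam b) {x₀ : X} (h0 : W x₀ = 0) {ε : ℝ → ℝ}
    (hε : ∀ ℓ, 2 * b + lam < (1 - lam) * ℓ → 0 < ε ℓ ∧
      ∃ ν : Measure X, ν.real Set.univ = ε ℓ ∧ ∀ x, W x ≤ ℓ → ν ≤ P x) :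
    ∃ π : Measure X, IsProbabilityMeasure π ∧ P.Invariant π ∧
      (∀ ℓ r : ℝ, 0 < ℓ → 0 < r → r < 1 → ∀ (x : X) (k : ℕ),
        EDULA.tvDist ((P ^ k) x) π ≤ (2 + b / (1 - lam) + W x) *
          (max ((1 - ε ℓ) ^ r) (((1 + 2 * b + lam + lam * ℓ) / (1 + ℓ)) ^ (1 - r) *
            (1 + 2 * b + 2 * lam * ℓ) ^ r)) ^ k) ∧
      (∀ ℓ, 2 * b + lam < (1 - lam) * ℓ → 0 < ε ℓ ∧ ∀ᶠ r in 𝓝[>] (0 : ℝ),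
        max ((1 - ε ℓ) ^ r) (((1 + 2 * b + lam + lam * ℓ) / (1 + ℓ)) ^ (1 - r) *
            (1 + 2 * b + 2 * lam * ℓ) ^ r) < 1) := by
  have hl := hd.lam_nonneg
  have hl1 : 0 < 1 - lam := by linarith [hd.lam_lt_one]
  have hb := hd.b_nonneg
  have hpos : ∀ ℓ, 2 * b + lam < (1 - lam) * ℓ → 0 < ℓ := fun ℓ hℓ =>
    pos_of_mul_pos_right (lt_of_le_of_lt (by positivity) hℓ) hl1.le
  have hmass : ∀ ℓ, 2 * b + lam < (1 - lam) * ℓ → ε ℓ ≤ 1 := fun ℓ hℓ => by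
    obtain ⟨-, ν, hν, hle⟩ := hε ℓ hℓ
    rw [← hν, ← probReal_univ (μ := P x₀)]
    exact ENNReal.toReal_mono (measure_ne_top _ _)
      (hle x₀ (h0.trans_le (hpos ℓ hℓ).le) Set.univ)
  have hβ : ∀ ℓ, 2 * b + lam < (1 - lam) * ℓ → (1 + 2 * b + lam + lam * ℓ) / (1 + ℓ) < 1 :=
    fun ℓ hℓ => by
      rw [div_lt_one (by linarith [hpos ℓ hℓ])]
      linarith
  have hrate : ∀ ℓ, 2 * b + lam < (1 - lam) * ℓ → ∀ᶠ r in 𝓝[>] (0 : ℝ),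
        max ((1 - ε ℓ) ^ r) (((1 + 2 * b + lam + lam * ℓ) / (1 + ℓ)) ^ (1 - r) *
            (1 + 2 * b + 2 * lam * ℓ) ^ r) < 1 := fun ℓ hℓ => by
    have hp := hpos ℓ hℓ
    exact rate_lt_one (hε ℓ hℓ).1 (hmass ℓ hℓ) (by positivity) (hβ ℓ hℓ) (by positivity)
  have hbound : ∀ ℓ, 2 * b + lam < (1 - lam) * ℓ → ∀ r : ℝ, 0 < r → ∀ A, MeasurableSet A →
      ∀ x k n, |((P ^ k) x).real A - ((P ^ (k + n)) x₀).real A| ≤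
        (max ((1 - ε ℓ) ^ r) (((1 + 2 * b + lam + lam * ℓ) / (1 + ℓ)) ^ (1 - r) *
            (1 + 2 * b + 2 * lam * ℓ) ^ r)) ^ k * (2 + b / (1 - lam) + W x) := by
    intro ℓ hℓ r hr A hA x k n
    obtain ⟨-, ν, hν, hle⟩ := hε ℓ hℓ
    have hm := hmass ℓ hℓ
    have hp := hpos ℓ hℓ
    rw [← hν] at hm ⊢
    refine abs_pow_sub_pow_add_le hd h0 hA k n (pow_nonneg (le_max_of_le_right (by positivity)) k)
      x fun y => abs_pow_sub_pow_le_rate hd hp hle hm (hβ ℓ hℓ).le hA k hr x y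
  obtain ⟨π, hπ, hlim⟩ : ∃ π : Measure X, IsProbabilityMeasure π ∧
      ∀ A, MeasurableSet A → Tendsto (fun n => ((P ^ n) x₀).real A) atTop (𝓝 (π.real A)) := by
    -- One contracting pair `ℓ`, `r` suffices to construct `π`; the bounds for other pairs then
    -- refer to the same limit.
    obtain ⟨ℓ, hℓ⟩ : ∃ ℓ, 2 * b + lam < (1 - lam) * ℓ :=
      ⟨(2 * b + lam + 1) / (1 - lam), by rw [mul_div_cancel₀ _ hl1.ne']; linarith⟩
    obtain ⟨r, hr1, hr0⟩ := ((hrate ℓ hℓ).and self_mem_nhdsWithin).exists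
    have hp := hpos ℓ hℓ
    refine exists_setwise_limit (fun n => (P ^ n) x₀) ?_
      fun A hA k n => hbound ℓ hℓ r hr0 A hA x₀ k n
    have := (tendsto_pow_atTop_nhds_zero_of_lt_one (le_max_of_le_right (by positivity))
      hr1).mul_const (2 + b / (1 - lam) + W x₀)
    simpa using this
  refine ⟨π, hπ, invariant_of_setwise_limit hlim, ?_, fun ℓ hℓ => ⟨(hε ℓ hℓ).1, hrate ℓ hℓ⟩⟩
  intro ℓ r hℓ0 hr hr1 x k
  have hWx := hd.nonneg x
  have hbl : 0 ≤ b / (1 - lam) := by positivity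
  by_cases hℓ : 2 * b + lam < (1 - lam) * ℓ
  · refine tvDist_le fun A hA => ?_
    rw [mul_comm (2 + b / (1 - lam) + W x)]
    have h1 : Tendsto (fun n => ((P ^ (k + n)) x₀).real A) atTop (𝓝 (π.real A)) :=
      (hlim A hA).comp (tendsto_add_atTop_nat k |>.congr fun n => by rw [add_comm])
    exact le_of_tendsto' (h1.const_sub _).abs fun n => hbound ℓ hℓ r hr A hA x k n
  -- For small `ℓ` no minorization is available, but then `β ≥ 1` and `B ≥ 1`, so the right-hand
  -- side is at least 1.
  · refine (tvDist_le_one _ _).trans ?_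
    have hβ1 : 1 ≤ (1 + 2 * b + lam + lam * ℓ) / (1 + ℓ) := by
      rw [one_le_div (by linarith)]
      linarith
    have hB1 : 1 ≤ 1 + 2 * b + 2 * lam * ℓ := by
      have : 0 ≤ 2 * b + 2 * lam * ℓ := by positivity
      linarith
    have h1 := one_le_mul_of_one_le_of_one_le (Real.one_le_rpow hβ1 (by linarith : 0 ≤ 1 - r))
      (Real.one_le_rpow hB1 hr.le)
    exact one_le_mul_of_one_le_of_one_le (by linarith)
      (one_le_pow₀ (h1.trans (le_max_right _ _)))

end DriftMinorization

namespace EDULA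

/-! ### Gaussian moments on Euclidean space. -/

section Gaussian

theorem integrable_gaussianPDFReal_mul_sq (m : ℝ) {v : ℝ≥0} (hv : v ≠ 0) :
    Integrable fun x : ℝ => gaussianPDFReal m v x * x ^ 2 := by
  have h := (memLp_id_gaussianReal (μ := m) (v := v) 2).integrable_sq
  rw [gaussianReal_of_var_ne_zero _ hv, integrable_withDensity_iff_integrable_smul'
    (measurable_gaussianPDF m v) (ae_of_all _ fun _ => gaussianPDF_lt_top)] at h
  simpa [toReal_gaussianPDF] using h

theorem integral_gaussianPDFReal_mul_sq (m : ℝ) {v : ℝ≥0} (hv : v ≠ 0) :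
    ∫ x : ℝ, gaussianPDFReal m v x * x ^ 2 = m ^ 2 + v := by
  have h := variance_eq_sub (memLp_id_gaussianReal (μ := m) (v := v) 2)
  have e := integral_gaussianReal_eq_integral_smul (μ := m) hv (f := fun x => x ^ 2)
  rw [variance_id_gaussianReal] at h
  simp only [Pi.pow_apply, id_eq, integral_id_gaussianReal] at h
  simp only [smul_eq_mul] at e
  linarith

theorem integrable_euclidean_prod {D : ℕ} {f : Fin D → ℝ → ℝ} (hf : ∀ i, Integrable (f i)) :
    Integrable fun y : E D => ∏ i, f i (y i) := by
  rw [← (PiLp.volume_preserving_toLp (Fin D)).integrable_comp_emb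
    (MeasurableEquiv.toLp 2 _).measurableEmbedding]
  exact Integrable.fintype_prod hf

theorem integral_euclidean_prod {D : ℕ} (f : Fin D → ℝ → ℝ) :
    ∫ y : E D, ∏ i, f i (y i) = ∏ i, ∫ x, f i x := by
  rw [← (PiLp.volume_preserving_toLp (Fin D)).integral_comp
    (MeasurableEquiv.toLp 2 _).measurableEmbedding]
  exact integral_fintype_prod_volume_eq_prod f

/-- The second moment of a product of one-dimensional Gaussian densities. -/
theorem lintegral_prod_gaussianPDFReal_mul_norm_sq {D : ℕ} (m : E D) {v : ℝ≥0} (hv : v ≠ 0) :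
    ∫⁻ y : E D, ENNReal.ofReal ((∏ i, gaussianPDFReal (m i) v (y i)) * ‖y‖ ^ 2) =
      ENNReal.ofReal (‖m‖ ^ 2 + v * D) := by
  -- Expanding `‖y‖ ^ 2` over coordinates gives a sum of product functions; in the `i`-th one only
  -- coordinate `i` carries the square.
  let f : Fin D → Fin D → ℝ → ℝ := fun i j x =>
    gaussianPDFReal (m j) v x * (if j = i then x ^ 2 else 1)
  have hf : ∀ i j, Integrable (f i j) := by
    intro i j
    by_cases h : j = i
    · simpa [f, h] using integrable_gaussianPDFReal_mul_sq (m i) hv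
    · simpa [f, h] using integrable_gaussianPDFReal (m j) v
  have hI : ∀ i j, ∫ x, f i j x = if j = i then m i ^ 2 + v else 1 := by
    intro i j
    by_cases h : j = i
    · simpa [f, h] using integral_gaussianPDFReal_mul_sq (m i) hv
    · simpa [f, h] using integral_gaussianPDFReal_eq_one (m j) hv
  have hfun : ∀ y : E D, (∏ i, gaussianPDFReal (m i) v (y i)) * ‖y‖ ^ 2 =
      ∑ i, ∏ j, f i j (y j) := by
    intro y
    simp only [f, Finset.prod_mul_distrib, Finset.prod_ite_eq', Finset.mem_univ, if_true]
    rw [← Finset.mul_sum, EuclideanSpace.real_norm_sq_eq]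
  have hint : Integrable fun y : E D => ∑ i, ∏ j, f i j (y j) :=
    integrable_finsetSum _ fun i _ => integrable_euclidean_prod (hf i)
  simp only [hfun]
  rw [← ofReal_integral_eq_lintegral_ofReal hint (ae_of_all _ fun y => ?_),
    integral_finsetSum _ fun i _ => integrable_euclidean_prod (hf i)]
  · simp only [integral_euclidean_prod, hI, Finset.prod_ite_eq', Finset.mem_univ, if_true]
    rw [Finset.sum_add_distrib, EuclideanSpace.real_norm_sq_eq]
    simp [mul_comm]
  · simp only [← hfun]
    exact mul_nonneg (Finset.prod_nonneg fun i _ => gaussianPDFReal_nonneg _ _ _) (sq_nonneg _)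

theorem lintegral_prod_gaussianPDFReal {D : ℕ} (m : E D) {v : ℝ≥0} (hv : v ≠ 0) :
    ∫⁻ y : E D, ENNReal.ofReal (∏ i, gaussianPDFReal (m i) v (y i)) = 1 := by
  rw [← ofReal_integral_eq_lintegral_ofReal
    (integrable_euclidean_prod fun i => integrable_gaussianPDFReal (m i) v)
    (ae_of_all _ fun y => Finset.prod_nonneg fun i _ => gaussianPDFReal_nonneg _ _ _),
    integral_euclidean_prod fun i => gaussianPDFReal (m i) v]
  simp [integral_gaussianPDFReal_eq_one _ hv]

end Gaussian

/-! ### The Langevin kernel: normalization and drift. -/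

variable {D : ℕ} {Θ : Fin D → Finset ℝ} {U : E D → ℝ} {α αa η s t : ℝ}

theorem auxDensity_eq_prod (hαa : 0 < αa) (θ θa y : E D) :
    auxDensity αa η t θ θa y =
      ∏ i, gaussianPDFReal ((θa + t • gradAux η θ θa) i) αa.toNNReal (y i) := by
  simp only [auxDensity, gaussianPDFReal, Finset.prod_mul_distrib, Finset.prod_const,
    Finset.card_univ, Fintype.card_fin, ← Real.exp_sum, Real.coe_toNNReal _ hαa.le, inv_pow]
  rw [EuclideanSpace.real_norm_sq_eq, ← Finset.sum_neg_distrib, Finset.sum_div]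
  congr 2
  refine Finset.sum_congr rfl fun i _ => ?_
  simp only [PiLp.sub_apply, PiLp.add_apply]
  ring

theorem lintegral_auxDensity (hαa : 0 < αa) (θ θa : E D) :
    ∫⁻ y, ENNReal.ofReal (auxDensity αa η t θ θa y) = 1 := by
  simp only [auxDensity_eq_prod hαa]
  exact lintegral_prod_gaussianPDFReal _ (Real.toNNReal_pos.2 hαa).ne'

theorem lintegral_auxDensity_mul_norm_sq (hαa : 0 < αa) (θ θa : E D) :
    ∫⁻ y, ENNReal.ofReal (auxDensity αa η t θ θa y * ‖y‖ ^ 2) =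
      ENNReal.ofReal (‖θa + t • gradAux η θ θa‖ ^ 2 + αa * D) := by
  simp only [auxDensity_eq_prod hαa]
  rw [lintegral_prod_gaussianPDFReal_mul_norm_sq _ (Real.toNNReal_pos.2 hαa).ne',
    Real.coe_toNNReal _ hαa.le]

theorem auxDensity_nonneg (θ θa y : E D) : 0 ≤ auxDensity αa η t θ θa y := by
  unfold auxDensity
  positivity

theorem measurable_auxDensity (θ θa : E D) : Measurable (auxDensity αa η t θ θa) := by
  unfold auxDensity
  fun_prop

theorem norm_le_supNorm (θ : Dom Θ) : ‖(θ : E D)‖ ≤ supNorm Θ :=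
  le_ciSup (f := fun θ : Dom Θ => ‖(θ : E D)‖) (Set.finite_range _).bddAbove θ

/-- The factor 2 in `driftRate` comes from `(a + b) ^ 2 ≤ 2 * (a ^ 2 + b ^ 2)`, applied to the two
parts of the mean. -/
theorem norm_auxMean_sq_le (x : State Θ) :
    ‖x.2 + t • gradAux η (x.1 : E D) x.2‖ ^ 2 ≤
      driftRate η t * V x + 2 * (t / η) ^ 2 * supNorm Θ ^ 2 := by
  have e : x.2 + t • gradAux η (x.1 : E D) x.2 = (1 - t / η) • x.2 + (t / η) • (x.1 : E D) := by
    rw [gradAux, smul_smul, smul_sub, sub_smul, one_smul, mul_one_div]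
    abel
  have h1 : ‖x.2 + t • gradAux η (x.1 : E D) x.2‖ ≤
      |1 - t / η| * ‖x.2‖ + |t / η| * ‖(x.1 : E D)‖ := by
    rw [e]
    refine (norm_add_le _ _).trans_eq ?_
    rw [norm_smul, norm_smul, Real.norm_eq_abs, Real.norm_eq_abs]
  have h2 := pow_le_pow_left₀ (norm_nonneg _) h1 2
  have h3 := add_sq_le (a := |1 - t / η| * ‖x.2‖) (b := |t / η| * ‖(x.1 : E D)‖)
  rw [mul_pow, mul_pow, sq_abs, sq_abs] at h3
  have h4 : (t / η) ^ 2 * ‖(x.1 : E D)‖ ^ 2 ≤ (t / η) ^ 2 * supNorm Θ ^ 2 :=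
    mul_le_mul_of_nonneg_left
      (pow_le_pow_left₀ (norm_nonneg _) (norm_le_supNorm x.1) 2) (sq_nonneg _)
  unfold driftRate V
  linarith

/-- The points of `Θ` as functions. -/
def domEquiv (Θ : Fin D → Finset ℝ) : Dom Θ ≃ Fintype.piFinset Θ where
  toFun θ := ⟨fun i => (θ : E D) i, Fintype.mem_piFinset.2 θ.2⟩
  invFun f := ⟨WithLp.toLp 2 f.1, fun i => Fintype.mem_piFinset.1 f.2 i⟩
  left_inv _ := rfl
  right_inv _ := rfl

theorem card_dom : Nat.card (Dom Θ) = ∏ i, (Θ i).card := by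
  rw [Nat.card_congr (domEquiv Θ), Nat.card_eq_fintype_card, Fintype.card_coe,
    Fintype.card_piFinset]

theorem sum_catProb {S : Finset ℝ} (hS : S.Nonempty) (u g : ℝ) :
    ∑ y ∈ S, catProb S α s u g y = 1 := by
  simp only [catProb]
  rw [← Finset.sum_div]
  exact div_self (Finset.sum_pos (fun _ _ => Real.exp_pos _) hS).ne'

theorem catProb_nonneg (S : Finset ℝ) (u g y : ℝ) : 0 ≤ catProb S α s u g y :=
  div_nonneg (Real.exp_pos _).le (Finset.sum_nonneg fun _ _ => (Real.exp_pos _).le)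

theorem mainDensity_nonneg (θ θa θ' : E D) : 0 ≤ mainDensity Θ U α η s θ θa θ' :=
  Finset.prod_nonneg fun _ _ => catProb_nonneg _ _ _ _

theorem lintegral_mainDensity (hΘ : ∀ i, (Θ i).Nonempty) (θ θa : E D) :
    ∫⁻ θ' : Dom Θ, ENNReal.ofReal (mainDensity Θ U α η s θ θa θ') ∂Measure.count = 1 := by
  have := Fintype.ofFinite (Dom Θ)
  rw [lintegral_count, tsum_fintype,
    ← ENNReal.ofReal_sum_of_nonneg fun _ _ => mainDensity_nonneg _ _ _, ← ENNReal.ofReal_one]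
  congr 1
  have h := Finset.prod_univ_sum Θ fun i y => catProb (Θ i) α s (θ i) (gradMain U η θ θa i) y
  simp only [sum_catProb (hΘ _), Finset.prod_const_one] at h
  rw [h, ← Finset.sum_coe_sort (Fintype.piFinset Θ)]
  exact Fintype.sum_equiv (domEquiv Θ) _ _ fun _ => rfl

/-- Since `V` sees only the second coordinate, the product form reduces the drift to a Gaussian
second moment. -/
theorem edulaKernel_apply_eq_prod (x : State Θ) :
    edulaKernel Θ U α αa η s t x =
      ((Measure.count : Measure (Dom Θ)).withDensity fun θ' =>
        ENNReal.ofReal (mainDensity Θ U α η s x.1 x.2 θ')).prod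
      ((volume : Measure (E D)).withDensity fun y =>
        ENNReal.ofReal (auxDensity αa η t x.1 x.2 y)) := by
  rw [prod_withDensity (measurable_of_finite _) (measurable_auxDensity _ _).ennreal_ofReal]
  simp only [← ENNReal.ofReal_mul (mainDensity_nonneg _ _ _)]
  rfl

theorem isProbabilityMeasure_aux (hαa : 0 < αa) (θ θa : E D) :
    IsProbabilityMeasure ((volume : Measure (E D)).withDensity fun y =>
        ENNReal.ofReal (auxDensity αa η t θ θa y)) :=
  ⟨by rw [withDensity_apply _ .univ, setLIntegral_univ, lintegral_auxDensity hαa]⟩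

theorem isProbabilityMeasure_main (hΘ : ∀ i, (Θ i).Nonempty) (θ θa : E D) :
    IsProbabilityMeasure ((Measure.count : Measure (Dom Θ)).withDensity fun θ' =>
        ENNReal.ofReal (mainDensity Θ U α η s θ θa θ')) :=
  ⟨by rw [withDensity_apply _ .univ, setLIntegral_univ, lintegral_mainDensity hΘ]⟩

theorem isMarkovKernel_edulaKernel (hΘ : ∀ i, (Θ i).Nonempty) (hαa : 0 < αa) :
    IsMarkovKernel (edulaKernel Θ U α αa η s t) := by
  refine ⟨fun x => ?_⟩
  have h1 := isProbabilityMeasure_aux (η := η) (t := t) hαa (x.1 : E D) x.2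
  have h2 := isProbabilityMeasure_main (U := U) (α := α) (η := η) (s := s) hΘ (x.1 : E D) x.2
  rw [edulaKernel_apply_eq_prod]
  infer_instance

theorem measurable_V : Measurable (V : State Θ → ℝ) := (measurable_snd.norm).pow_const 2

theorem driftConst_nonneg (hαa : 0 < αa) : 0 ≤ driftConst Θ αa η t := by
  unfold driftConst
  positivity

theorem driftRate_nonneg : 0 ≤ driftRate η t := by
  unfold driftRate
  positivity

theorem hasDrift_edulaKernel (hΘ : ∀ i, (Θ i).Nonempty) (hαa : 0 < αa)
    (hdrift : driftRate η t < 1) :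
    DriftMinorization.HasDrift (edulaKernel Θ U α αa η s t) V (driftRate η t)
      (driftConst Θ αa η t) where
  measurable := measurable_V
  nonneg x := sq_nonneg _
  lam_nonneg := driftRate_nonneg
  lam_lt_one := hdrift
  b_nonneg := driftConst_nonneg hαa
  lintegral_le x := by
    have h1 := isProbabilityMeasure_aux (η := η) (t := t) hαa (x.1 : E D) x.2
    have h2 := isProbabilityMeasure_main (U := U) (α := α) (η := η) (s := s) hΘ (x.1 : E D) x.2
    have hm : Measurable fun y : E D => ENNReal.ofReal (‖y‖ ^ 2) := by fun_prop
    rw [edulaKernel_apply_eq_prod, lintegral_prod _ measurable_V.ennreal_ofReal.aemeasurable]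
    simp only [V, lintegral_const, measure_univ, mul_one]
    rw [lintegral_withDensity_eq_lintegral_mul _ (measurable_auxDensity _ _).ennreal_ofReal hm]
    simp only [Pi.mul_apply, ← ENNReal.ofReal_mul (auxDensity_nonneg _ _ _)]
    rw [lintegral_auxDensity_mul_norm_sq hαa]
    refine ENNReal.ofReal_le_ofReal ?_
    have := norm_auxMean_sq_le (η := η) (t := t) x
    unfold V at this
    unfold driftConst
    linarith

/-! ### Minorization on sublevel sets of `V`. -/

/-- The hypothesis `hℓ` keeps the squared norm of the mean below `ℓ`, so the squared distance from
`y` to it is at most `4 * ℓ`; dividing by `2 * αa` gives the exponent. -/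
theorem le_auxDensity (hαa : 0 < αa) {ℓ : ℝ}
    (hℓ : driftRate η t * ℓ + driftConst Θ αa η t ≤ ℓ) {x : State Θ} (hx : V x ≤ ℓ) {y : E D}
    (hy : ‖y‖ ^ 2 ≤ ℓ) :
    (√(2 * Real.pi * αa) ^ D)⁻¹ * Real.exp (-(2 * ℓ / αa)) ≤ auxDensity αa η t x.1 x.2 y := by
  unfold auxDensity
  refine mul_le_mul_of_nonneg_left (Real.exp_le_exp.2 ?_) (by positivity)
  have h1 := norm_auxMean_sq_le (η := η) (t := t) x
  have h2 : driftRate η t * V x ≤ driftRate η t * ℓ :=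
    mul_le_mul_of_nonneg_left hx driftRate_nonneg
  have h3 : 0 ≤ αa * D := by positivity
  have h4 := pow_le_pow_left₀ (norm_nonneg _)
    (norm_sub_le y (x.2 + t • gradAux η (x.1 : E D) x.2)) 2
  have h5 := add_sq_le (a := ‖y‖) (b := ‖x.2 + t • gradAux η (x.1 : E D) x.2‖)
  unfold driftConst at hℓ
  rw [sub_sub, neg_div, neg_le_neg_iff, div_le_div_iff₀ (by positivity) hαa]
  nlinarith

/-- Each weight is at most 1, so the `i`-th normalizer is at most the size of `Θ i`, and these sizes
multiply to the size of `Dom Θ`. -/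
theorem le_mainDensity (hα : 0 < α) (hΘ : ∀ i, (Θ i).Nonempty) (θ θa : E D) (θ' : E D) :
    (Nat.card (Dom Θ) : ℝ)⁻¹ *
      Real.exp (-(1 / (2 * α)) * ‖θ' - θ - s • gradMain U η θ θa‖ ^ 2) ≤
      mainDensity Θ U α η s θ θa θ' := by
  have h : ∀ i, ((Θ i).card : ℝ)⁻¹ *
      Real.exp (-(θ' i - θ i - s * gradMain U η θ θa i) ^ 2 / (2 * α)) ≤
      catProb (Θ i) α s (θ i) (gradMain U η θ θa i) (θ' i) := by
    intro i
    have h1 : ∑ z ∈ Θ i, Real.exp (-(z - θ i - s * gradMain U η θ θa i) ^ 2 / (2 * α)) ≤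
        (Θ i).card := by
      refine (Finset.sum_le_card_nsmul _ _ 1 fun z _ => ?_).trans_eq (by simp)
      rw [Real.exp_le_one_iff]
      exact div_nonpos_of_nonpos_of_nonneg (neg_nonpos.2 (sq_nonneg _)) (by positivity)
    rw [catProb, inv_mul_eq_div]
    exact div_le_div_of_nonneg_left (Real.exp_pos _).le
      (Finset.sum_pos (fun _ _ => Real.exp_pos _) (hΘ i)) h1
  refine le_of_eq_of_le ?_ (Finset.prod_le_prod (fun i _ => by positivity) fun i _ => h i)
  rw [Finset.prod_mul_distrib, Finset.prod_inv_distrib, ← Real.exp_sum, card_dom,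
    EuclideanSpace.real_norm_sq_eq, Finset.mul_sum]
  push_cast
  congr 2
  refine Finset.sum_congr rfl fun i _ => ?_
  simp only [PiLp.sub_apply, PiLp.smul_apply, smul_eq_mul]
  ring

theorem isBounded_dom : Bornology.IsBounded (Dom Θ) := (Set.toFinite (Dom Θ)).isBounded

theorem norm_proposal_le {L : ℝ≥0} (hL : LipschitzWith L (gradient U)) {a : E D}
    (ha : a ∈ Dom Θ) (hη : 0 < η) {ℓ : ℝ} {x : State Θ} (hx : V x ≤ ℓ) (θ' : Dom Θ) :
    ‖(θ' : E D) - x.1 - s • gradMain U η (x.1 : E D) x.2‖ ≤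
      (1 + |s| * L) * Metric.diam (Dom Θ) + |s| * ‖gradient U a‖ +
        |s| / η * (supNorm Θ + √ℓ) := by
  have h1 : ‖(θ' : E D) - x.1‖ ≤ Metric.diam (Dom Θ) := by
    rw [← dist_eq_norm]
    exact Metric.dist_le_diam_of_mem isBounded_dom θ'.2 x.1.2
  have h2 : ‖gradient U (x.1 : E D)‖ ≤ ‖gradient U a‖ + L * Metric.diam (Dom Θ) := by
    have h3 := hL.dist_le_mul (x.1 : E D) a
    have h4 : (L : ℝ) * dist (x.1 : E D) a ≤ L * Metric.diam (Dom Θ) :=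
      mul_le_mul_of_nonneg_left (Metric.dist_le_diam_of_mem isBounded_dom x.1.2 ha) L.2
    rw [dist_eq_norm] at h3
    linarith [norm_le_norm_add_norm_sub' (gradient U (x.1 : E D)) (gradient U a)]
  have h3 : ‖(x.1 : E D) - x.2‖ ≤ supNorm Θ + √ℓ :=
    (norm_sub_le _ _).trans (add_le_add (norm_le_supNorm x.1) (Real.le_sqrt_of_sq_le hx))
  have h4 : ‖gradMain U η (x.1 : E D) x.2‖ ≤
      ‖gradient U a‖ + L * Metric.diam (Dom Θ) + 1 / η * (supNorm Θ + √ℓ) := by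
    refine (norm_sub_le _ _).trans (add_le_add h2 ?_)
    rw [norm_smul, Real.norm_of_nonneg (by positivity)]
    gcongr
  calc ‖(θ' : E D) - x.1 - s • gradMain U η (x.1 : E D) x.2‖
      ≤ ‖(θ' : E D) - x.1‖ + |s| * ‖gradMain U η (x.1 : E D) x.2‖ := by
        refine (norm_sub_le _ _).trans_eq ?_
        rw [norm_smul, Real.norm_eq_abs]
    _ ≤ Metric.diam (Dom Θ) +
        |s| * (‖gradient U a‖ + L * Metric.diam (Dom Θ) + 1 / η * (supNorm Θ + √ℓ)) := by gcongr
    _ = _ := by ring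

theorem minorLevel_le_transDensity {L : ℝ≥0} (hL : LipschitzWith L (gradient U)) {a : E D}
    (ha : a ∈ Dom Θ) (hα : 0 < α) (hαa : 0 < αa) (hη : 0 < η) {ℓ : ℝ}
    (hℓ : driftRate η t * ℓ + driftConst Θ αa η t ≤ ℓ) {x x' : State Θ} (hx : V x ≤ ℓ)
    (hx' : V x' ≤ ℓ) :
    minorLevel Θ α αa η s L ‖gradient U a‖ ℓ ≤ transDensity Θ U α αa η s t x x' := by
  rw [minorLevel, transDensity, mul_comm (mainDensity _ _ _ _ _ _ _ _)]
  refine mul_le_mul (le_auxDensity hαa hℓ hx hx') ?_ (by positivity) (auxDensity_nonneg _ _ _)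
  refine le_trans ?_ (le_mainDensity hα (fun i => ⟨a i, ha i⟩) _ _ _)
  refine mul_le_mul_of_nonneg_left (Real.exp_le_exp.2 ?_) (by positivity)
  rw [neg_mul, neg_mul, neg_le_neg_iff]
  refine mul_le_mul_of_nonneg_left ?_ (by positivity)
  exact pow_le_pow_left₀ (norm_nonneg _) (norm_proposal_le hL ha hη hx x'.1) 2

theorem measurableSet_smallSet (ℓ : ℝ) : MeasurableSet (smallSet Θ ℓ) :=
  measurableSet_le measurable_V measurable_const

theorem exists_minorization {L : ℝ≥0} (hL : LipschitzWith L (gradient U)) {a : E D}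
    (ha : a ∈ Dom Θ) (hα : 0 < α) (hαa : 0 < αa) (hη : 0 < η) {ℓ : ℝ}
    (hℓ : driftRate η t * ℓ + driftConst Θ αa η t ≤ ℓ) :
    ∃ ν : Measure (State Θ),
      ν.real Set.univ = minorMass Θ α αa η s L ‖gradient U a‖ ℓ ∧
      ∀ x, V x ≤ ℓ → ν ≤ edulaKernel Θ U α αa η s t x := by
  have hlevel : 0 ≤ minorLevel Θ α αa η s L ‖gradient U a‖ ℓ := by
    unfold minorLevel
    positivity
  refine ⟨(refMeasure Θ).withDensity ((smallSet Θ ℓ).indicator fun _ =>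
    ENNReal.ofReal (minorLevel Θ α αa η s L ‖gradient U a‖ ℓ)), ?_, fun x hx => ?_⟩
  · rw [withDensity_indicator (measurableSet_smallSet ℓ), withDensity_const, minorMass,
      measureReal_ennreal_smul_apply, ENNReal.toReal_ofReal hlevel]
    simp
  · refine withDensity_mono (ae_of_all _ fun x' => ?_)
    by_cases hx' : x' ∈ smallSet Θ ℓ
    · rw [Set.indicator_of_mem hx']
      exact ENNReal.ofReal_le_ofReal (minorLevel_le_transDensity hL ha hα hαa hη hℓ hx hx')
    · rw [Set.indicator_of_notMem hx']
      exact zero_le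

theorem smallSet_eq_prod {ℓ : ℝ} (hℓ : 0 < ℓ) :
    smallSet Θ ℓ = Set.univ ×ˢ Metric.closedBall (0 : E D) √ℓ := by
  ext x
  simp [smallSet, V, Real.le_sqrt (norm_nonneg _) hℓ.le]

theorem minorMass_pos {a : E D} (ha : a ∈ Dom Θ) (hαa : 0 < αa) {L G ℓ : ℝ} (hℓ : 0 < ℓ) :
    0 < minorMass Θ α αa η s L G ℓ := by
  have hne : Nonempty (Dom Θ) := ⟨⟨a, ha⟩⟩
  have hc : (0 : ℝ) < Nat.card (Dom Θ) := Nat.cast_pos.2 Nat.card_pos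
  refine mul_pos (by unfold minorLevel; positivity) ?_
  rw [smallSet_eq_prod hℓ, refMeasure, measureReal_prod_prod]
  refine mul_pos ?_ ?_
  · refine ENNReal.toReal_pos ?_ (measure_ne_top _ _)
    exact Measure.count_ne_zero Set.univ_nonempty
  · exact ENNReal.toReal_pos (Metric.measure_closedBall_pos _ _ (Real.sqrt_pos.2 hℓ)).ne'
      measure_closedBall_lt_top.ne

end EDULA

theorem mainTheorem4 {D : ℕ} (Θ : Fin D → Finset ℝ) (U : EDULA.E D → ℝ) (L : ℝ≥0)
    (hU : ContDiff ℝ 2 U) (hL : LipschitzWith L (gradient U))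
    (a : EDULA.E D) (ha : a ∈ EDULA.Dom Θ)
    (ha_min : ∀ θ ∈ EDULA.Dom Θ, ‖gradient U a‖ ≤ ‖gradient U θ‖)
    (α αa η s t : ℝ) (hα : 0 < α) (hαa : 0 < αa) (hη : 0 < η)
    (hdrift : EDULA.driftRate η t < 1) :
    ∃ π : Measure (EDULA.State Θ), IsProbabilityMeasure π ∧
      (EDULA.edulaKernel Θ U α αa η s t).Invariant π ∧
      (∀ ℓ r : ℝ, 0 < ℓ → 0 < r → r < 1 → ∀ (x : EDULA.State Θ) (k : ℕ),
        EDULA.tvDist ((EDULA.edulaKernel Θ U α αa η s t ^ k) x) π ≤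
          EDULA.prefactor Θ αa η t x *
            EDULA.rate Θ α αa η s t L ‖gradient U a‖ ℓ r ^ k) ∧
      (∀ ℓ : ℝ,
        2 * EDULA.driftConst Θ αa η t + EDULA.driftRate η t < (1 - EDULA.driftRate η t) * ℓ →
          0 < EDULA.minorMass Θ α αa η s L ‖gradient U a‖ ℓ ∧
          ∀ᶠ r in 𝓝[>] (0 : ℝ), EDULA.rate Θ α αa η s t L ‖gradient U a‖ ℓ r < 1) := by
  have hΘ : ∀ i, (Θ i).Nonempty := fun i => ⟨a i, ha i⟩
  have hMarkov := EDULA.isMarkovKernel_edulaKernel (U := U) (α := α) (η := η) (s := s) (t := t)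
    hΘ hαa
  have hd := EDULA.hasDrift_edulaKernel (U := U) (α := α) (s := s) hΘ hαa hdrift
  refine DriftMinorization.exists_invariant_of_drift_of_minorization hd
    -- `V` vanishes where the auxiliary variable is 0.
    (x₀ := (⟨a, ha⟩, 0)) (by simp [EDULA.V])
    (ε := EDULA.minorMass Θ α αa η s L ‖gradient U a‖) fun ℓ hℓ => ?_
  have hl := hd.lam_nonneg
  have hb := hd.b_nonneg
  have hpos : 0 < ℓ :=
    pos_of_mul_pos_right (lt_of_le_of_lt (by positivity) hℓ) (by linarith)
  -- The condition on `ℓ` is stronger than the `lam * ℓ + b ≤ ℓ` needed for the minorization.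
  exact ⟨EDULA.minorMass_pos ha hαa hpos,
    EDULA.exists_minorization hL ha hα hαa hη (by linarith)⟩
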